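/- A two-stage scheme for $M$ messages, of length $n$ and with one use of noiseless feedback at time $n_1$ (where $1<n_1<n$), consists of two maps $f:[M]\to\{0,1\}^{n_1}$ and $g:[M]\times\{0,1\}^{n_1}\to\{0,1\}^{n-n_1}$. To send a message $m$, one first transmits $f(m)$ over the Z-channel. Once its output $y_1\in\{0,1\}^{n_1}$ is known, one transmits $g(m,y_1)$, with output $y_2\in\{0,1\}^{n-n_1}$. An adversary controls the channel and may change transmitted ones to zeros, but never zeros to ones; each such change is an error. The scheme corrects $t$ errors if some decoder recovers $m$ from $(y_1,y_2)$ for every message $m$ and every output $(y_1,y_2)$ that arises from at most $t$ errors in total over the two stages. Let $M_Z^{(2)}(n,t)$ be the largest $M$ for which a two-stage scheme of length $n$ that corrects $t$ errors exists, where $n_1$ may be chosen depending on $n$ and $t$. For $\tau\ge 0$ let $$R_Z^{(2)}(\tau):=\limsup_{n\to\infty}\frac{\log_2 M_Z^{(2)}(n,\lfloor\tau n\rfloor)}{n}.$$ **Theorem.** The maximum $\tau_{\max}:=\max_{0<\omega<1}\frac{\omega+\omega^3}{1+4\omega^3}$ is attained, and $\tau_{\max}\approx 0.44$ (namely $|\tau_{\max}-0.44|<0.005$).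 Moreover, $R_Z^{(2)}(\tau)>0$ for all $0\le\tau<\tau_{\max}$, and $R_Z^{(2)}(\tau)=0$ for all $\tau>\tau_{\max}$. -/

import Mathlib

open Filter

namespace ZChannel

/-- Binary words of length `n`. -/
abbrev Word (n : ℕ) : Type := Fin n → Bool

/-- `Δ(x, y)`: the number of positions `i` with `x i = 1` and `y i = 0`. -/
def numErrors {n : ℕ} (x y : Word n) : ℕ :=
  (Finset.univ.filter fun i => x i = true ∧ y i = false).card

/-- The Z-channel may turn the input `x` into `y`: a `1` is received only where a `1` was sent. -/
def CanReceive {n : ℕ} (x y : Word n) : Prop :=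
  ∀ i, y i = true → x i = true

/-- A two-stage encoder for `M` messages with `n₁` channel uses before and `n₂` channel uses
after the single use of the noiseless feedback. -/
structure TwoStageEncoder (n₁ n₂ M : ℕ) where
  /-- The word sent in the first stage. -/
  first : Fin M → Word n₁
  /-- The word sent in the second stage, given the received output of the first stage. -/
  second : Fin M → Word n₁ → Word n₂

/-- The pair of outputs `(y₁, y₂)` can be received when the message `m` is sent and the adversary
makes at most `t` errors in total. -/
def TwoStageEncoder.IsOutput {n₁ n₂ M : ℕ} (E : TwoStageEncoder n₁ n₂ M) (t : ℕ) (m : Fin M)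
    (y₁ : Word n₁) (y₂ : Word n₂) : Prop :=
  CanReceive (E.first m) y₁ ∧ CanReceive (E.second m y₁) y₂ ∧
    numErrors (E.first m) y₁ + numErrors (E.second m y₁) y₂ ≤ t

/-- Some decoder recovers the message from every output of an adversary who makes at most `t`
errors in total. -/
def TwoStageEncoder.Corrects {n₁ n₂ M : ℕ} (E : TwoStageEncoder n₁ n₂ M) (t : ℕ) : Prop :=
  ∃ dec : Word n₁ → Word n₂ → Fin M,
    ∀ (m : Fin M) (y₁ : Word n₁) (y₂ : Word n₂), E.IsOutput t m y₁ y₂ → dec y₁ y₂ = m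

/-- `M` messages can be transmitted in `n` channel uses with at most `t` errors, for a suitable
feedback moment `n₁` with `1 < n₁ < n`, which is fixed beforehand. -/
def Transmittable (n t M : ℕ) : Prop :=
  ∃ n₁ n₂ : ℕ, 1 < n₁ ∧ 0 < n₂ ∧ n₁ + n₂ = n ∧
    ∃ E : TwoStageEncoder n₁ n₂ M, E.Corrects t

/-- The maximum number of messages that two-stage coding can transmit in `n` channel uses with at
most `t` errors. -/
noncomputable def maxMessages (n t : ℕ) : ℕ := sSup {M : ℕ | Transmittable n t M}

lemma Transmittable.le_two_pow {n t M : ℕ} (h : Transmittable n t M) : M ≤ 2 ^ n := by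
  obtain ⟨n₁, n₂, -, -, rfl, E, dec, hdec⟩ := h
  have hself : ∀ m, E.IsOutput t m (E.first m) (E.second m (E.first m)) := by
    intro m
    refine ⟨fun _ hi => hi, fun _ hi => hi, ?_⟩
    have hz : ∀ {k : ℕ} (x : Word k), numErrors x x = 0 := by
      intro k x
      simp [numErrors]
    simp [hz]
  have hinj : Function.Injective
      (fun m => ((E.first m, E.second m (E.first m)) : Word n₁ × Word n₂)) := by
    intro a b hab
    simp only [Prod.mk.injEq] at hab
    have ha := hdec a _ _ (hself a)
    have hb := hdec b _ _ (hself b)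
    rw [hab.1] at ha
    rw [← hb, ← ha, ← hab.2, hab.1]
  have := Fintype.card_le_of_injective _ hinj
  simpa [pow_add] using this

lemma transmittable_one {n : ℕ} (hn : 3 ≤ n) (t : ℕ) : Transmittable n t 1 :=
  ⟨2, n - 2, by omega, by omega, by omega,
    ⟨fun _ _ => false, fun _ _ _ => false⟩, fun _ _ => 0, fun _ _ _ _ => Subsingleton.elim _ _⟩

/-- The supremum in the definition of `maxMessages` is a maximum. -/
lemma isGreatest_maxMessages {n : ℕ} (hn : 3 ≤ n) (t : ℕ) :
    IsGreatest {M : ℕ | Transmittable n t M} (maxMessages n t) := by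
  have hb : BddAbove {M : ℕ | Transmittable n t M} := ⟨2 ^ n, fun _ h => h.le_two_pow⟩
  exact ⟨Nat.sSup_mem ⟨1, transmittable_one hn t⟩ hb, fun _ h => le_csSup hb h⟩

/-- The maximal asymptotic rate of two-stage error-correcting codes for the Z-channel, for a
fraction `τ ≥ 0` of errors. The sequence takes values in `[0, 1]`. -/
noncomputable def rate (τ : ℝ) : ℝ :=
  limsup (fun n : ℕ => Real.logb 2 (maxMessages n ⌊τ * n⌋₊ : ℝ) / n) atTop

/-- The function `(ω + ω³) / (1 + 4 ω³)`. -/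
noncomputable def plotkinFun (ω : ℝ) : ℝ := (ω + ω ^ 3) / (1 + 4 * ω ^ 3)

/-- The maximum of `plotkinFun` over `0 < ω < 1`. -/
noncomputable def tauMax : ℝ := sSup (plotkinFun '' Set.Ioo 0 1)

end ZChannel

/-!
Upper bound: the adversary has two strategies against many messages whose words in the first stage
have weight about `ω n₁`. He can erase the first stage altogether, at a cost of `ω n₁`, after which
the Plotkin bound leaves some pair of messages at distance at most `n₂ / 4`. Or he can use that
three of the words share about `ω³ n₁` ones, which reduces the cost of the first stage to
`(ω - ω³) n₁`; in the second stage, two of any three words are at distance at most `n₂ / 2`. In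
every split of `n` into `n₁ + n₂`, one of the two costs about `plotkinFun ω * n` at most, provided
that `ω ≥ 1 / 4`; for smaller `ω`, erasing the first stage is cheap.

Lower bound: take a random code of weight `w n₁` for the first stage, where `w` maximizes
`plotkinFun`. An output that is compatible with `L` messages costs the adversary `(w - w ^ L) n₁`
errors. The encoder knows these messages, so that the second stage only has to tell `L` words apart,
and sufficiently good codes exist for every `L ≥ 2`. The split `n₁ = n / (1 + 4 w³)` makes the
total cost of each list at least that of three messages.
-/

namespace ZChannel

open Finset
open scoped Topology

/-! ### The function `plotkinFun` and its maximum -/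

lemma hasDerivAt_plotkinFun {ω : ℝ} (hω : 0 ≤ ω) :
    HasDerivAt plotkinFun ((1 - ω ^ 2 * (8 * ω - 3)) / (1 + 4 * ω ^ 3) ^ 2) ω := by
  have hnum : HasDerivAt (fun x : ℝ => x + x ^ 3) (1 + 3 * ω ^ 2) ω := by
    simpa using (hasDerivAt_id' ω).fun_add (hasDerivAt_pow 3 ω)
  have hden : HasDerivAt (fun x : ℝ => 1 + 4 * x ^ 3) (4 * (3 * ω ^ 2)) ω := by
    simpa using ((hasDerivAt_pow 3 ω).const_mul 4).const_add 1
  exact (hnum.fun_div hden (by positivity)).congr_deriv (by ring)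

lemma exists_isMaxOn_plotkinFun :
    ∃ w ∈ Set.Icc (1 / 3 : ℝ) (2 / 3), IsMaxOn plotkinFun (Set.Icc 0 1) w := by
  have hcont : ContinuousOn plotkinFun (Set.Icc 0 1) := fun x hx =>
    (hasDerivAt_plotkinFun hx.1).continuousAt.continuousWithinAt
  obtain ⟨w, hw, hmax⟩ := isCompact_Icc.exists_isMaxOn (Set.nonempty_Icc.2 zero_le_one) hcont
  have hge : plotkinFun (2 / 3) ≤ plotkinFun w := hmax (by norm_num)
  have h0 : 0 < w := hw.1.lt_of_ne fun h => by norm_num [← h, plotkinFun] at hge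
  have h1 : w < 1 := hw.2.lt_of_ne fun h => by norm_num [h, plotkinFun] at hge
  have hderiv := (hmax.isLocalMax (Icc_mem_nhds h0 h1)).hasDerivAt_eq_zero
    (hasDerivAt_plotkinFun h0.le)
  have hcrit : w ^ 2 * (8 * w - 3) = 1 := by
    rw [div_eq_zero_iff, or_iff_left (by positivity)] at hderiv
    linarith
  refine ⟨w, ⟨?_, ?_⟩, hmax⟩ <;> by_contra! h
  · nlinarith [sq_nonneg w]
  · have : 4 / 9 < w ^ 2 := by nlinarith
    nlinarith

lemma isGreatest_of_isMaxOn_plotkinFun {w : ℝ} (hw : w ∈ Set.Ioo (0 : ℝ) 1)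
    (h : IsMaxOn plotkinFun (Set.Icc 0 1) w) :
    IsGreatest (plotkinFun '' Set.Ioo 0 1) (plotkinFun w) :=
  ⟨⟨w, hw, rfl⟩, Set.forall_mem_image.2 fun _ hx => h (Set.Ioo_subset_Icc_self hx)⟩

lemma exists_plotkinFun_eq_tauMax :
    ∃ w ∈ Set.Icc (1 / 3 : ℝ) (2 / 3), plotkinFun w = tauMax ∧
      IsMaxOn plotkinFun (Set.Icc 0 1) w := by
  obtain ⟨w, hw, hmax⟩ := exists_isMaxOn_plotkinFun
  have hgreatest := isGreatest_of_isMaxOn_plotkinFun ⟨by linarith [hw.1], by linarith [hw.2]⟩ hmax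
  exact ⟨w, hw, hgreatest.csSup_eq.symm, hmax⟩

lemma isGreatest_tauMax : IsGreatest (plotkinFun '' Set.Ioo 0 1) tauMax := by
  obtain ⟨w, hw, heq, hmax⟩ := exists_plotkinFun_eq_tauMax
  exact heq ▸ isGreatest_of_isMaxOn_plotkinFun ⟨by linarith [hw.1], by linarith [hw.2]⟩ hmax

lemma plotkinFun_le_tauMax {ω : ℝ} (hω : ω ∈ Set.Icc (0 : ℝ) 1) : plotkinFun ω ≤ tauMax := by
  obtain ⟨w, -, heq, hmax⟩ := exists_plotkinFun_eq_tauMax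
  exact heq ▸ hmax hω

lemma le_tauMax : 26 / 59 ≤ tauMax := by
  have h : plotkinFun (2 / 3) = 26 / 59 := by norm_num [plotkinFun]
  exact h ▸ plotkinFun_le_tauMax (by norm_num)

lemma plotkinFun_lt {ω : ℝ} (hω : 0 ≤ ω) : plotkinFun ω < 0.445 := by
  rw [plotkinFun, div_lt_iff₀ (by positivity)]
  -- The difference of the two sides is minimal near `ω = 0.654`.
  nlinarith [mul_nonneg (add_nonneg hω (by norm_num : (0 : ℝ) ≤ 1.308)) (sq_nonneg (ω - 0.654))]

lemma tauMax_lt : tauMax < 0.445 := by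
  obtain ⟨w, hw, heq, -⟩ := exists_plotkinFun_eq_tauMax
  exact heq ▸ plotkinFun_lt (by linarith [hw.1])

lemma abs_tauMax_sub_lt : |tauMax - 0.44| < 0.005 := by
  rw [abs_lt]
  constructor <;> linarith [le_tauMax, tauMax_lt]

-- Both bounds agree when `b = 4 ω³ a`, and there they are equal to `plotkinFun ω * (a + b)`.
lemma le_plotkinFun_mul {ω a b s : ℝ} (hω : 1 / 4 ≤ ω) (h₁ : s ≤ ω * a + b / 4)
    (h₂ : s ≤ (ω - ω ^ 3) * a + b / 2) : s ≤ plotkinFun ω * (a + b) := by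
  have hden : 0 < 1 + 4 * ω ^ 3 := by positivity
  have hcoeff : 0 ≤ 2 - 4 * ω + 4 * ω ^ 3 := by
    nlinarith [mul_nonneg (by linarith : 0 ≤ ω + 6 / 5) (sq_nonneg (ω - 3 / 5))]
  rw [plotkinFun, div_mul_eq_mul_div, le_div_iff₀ hden]
  calc s * (1 + 4 * ω ^ 3)
      = (2 - 4 * ω + 4 * ω ^ 3) * s + (4 * ω - 1) * s := by ring
    _ ≤ (2 - 4 * ω + 4 * ω ^ 3) * (ω * a + b / 4)
          + (4 * ω - 1) * ((ω - ω ^ 3) * a + b / 2) := by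
        gcongr
        linarith
    _ = (ω + ω ^ 3) * (a + b) := by ring

lemma le_tauMax_mul {ω a b s : ℝ} (hω : ω ≤ 1) (ha : 0 ≤ a) (hb : 0 ≤ b)
    (h₁ : s ≤ ω * a + b / 4) (h₂ : s ≤ (ω - ω ^ 3) * a + b / 2) : s ≤ tauMax * (a + b) := by
  rcases lt_or_ge ω (1 / 4) with h | h
  · have hωa : ω * a ≤ 1 / 4 * a := by gcongr
    have hτ : 1 / 4 * (a + b) ≤ tauMax * (a + b) := by
      gcongr
      linarith [le_tauMax]
    linarith
  · calc s ≤ plotkinFun ω * (a + b) := le_plotkinFun_mul h h₁ h₂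
      _ ≤ tauMax * (a + b) := by
        gcongr
        exact plotkinFun_le_tauMax ⟨by linarith, hω⟩

/-! ### Errors and confusable messages -/

/-- The set of positions at which a word carries a one; its cardinality is the weight. -/
def ones {n : ℕ} (x : Word n) : Finset (Fin n) := {i | x i = true}

section Word

variable {n : ℕ} {x x' y : Word n}

@[simp]
lemma mem_ones {i : Fin n} : i ∈ ones x ↔ x i = true := by simp [ones]

lemma ones_inf (x y : Word n) : ones (x ⊓ y) = ones x ∩ ones y := by ext i; simp

lemma card_ones_le (x : Word n) : #(ones x) ≤ n := by simpa using card_le_univ (ones x)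

lemma numErrors_eq_card_sdiff (x y : Word n) : numErrors x y = #(ones x \ ones y) :=
  congrArg card (by ext i; simp)

lemma canReceive_iff_ones_subset : CanReceive x y ↔ ones y ⊆ ones x := by
  simp [CanReceive, subset_iff]

lemma canReceive_inf_left (x y : Word n) : CanReceive x (x ⊓ y) := by
  simp [canReceive_iff_ones_subset, ones_inf, inter_subset_left]

lemma canReceive_inf_right (x y : Word n) : CanReceive y (x ⊓ y) := by
  simp [canReceive_iff_ones_subset, ones_inf, inter_subset_right]

lemma numErrors_inf_left (x y : Word n) : numErrors x (x ⊓ y) = numErrors x y := by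
  simp [numErrors_eq_card_sdiff, ones_inf]

lemma numErrors_inf_right (x y : Word n) : numErrors y (x ⊓ y) = numErrors y x := by
  simp [numErrors_eq_card_sdiff, ones_inf]

lemma CanReceive.numErrors_add_card_ones (h : CanReceive x y) :
    numErrors x y + #(ones y) = #(ones x) := by
  rw [numErrors_eq_card_sdiff, card_sdiff_add_card_eq_card (canReceive_iff_ones_subset.1 h)]

lemma numErrors_add_card_ones_comm (x y : Word n) :
    numErrors x y + #(ones y) = numErrors y x + #(ones x) := by
  simp_rw [numErrors_eq_card_sdiff, card_sdiff_add_card, union_comm]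

lemma CanReceive.numErrors_le (h : CanReceive x' y) (x : Word n) :
    numErrors x x' ≤ numErrors x y := by
  simp_rw [numErrors_eq_card_sdiff]
  exact card_le_card (sdiff_subset_sdiff Subset.rfl (canReceive_iff_ones_subset.1 h))

lemma numErrors_add_numErrors_le (x y z : Word n) : numErrors x y + numErrors y z ≤ n := by
  simp_rw [numErrors_eq_card_sdiff]
  rw [← card_union_of_disjoint (disjoint_sdiff_self_left.mono_right sdiff_subset)]
  simpa using card_le_univ (ones x \ ones y ∪ ones y \ ones z)

end Word

namespace TwoStageEncoder

variable {n₁ n₂ M t : ℕ} {E : TwoStageEncoder n₁ n₂ M}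

lemma Corrects.lt_or_lt (hE : E.Corrects t) {m m' : Fin M} (hm : m ≠ m') {y : Word n₁}
    (h : CanReceive (E.first m) y) (h' : CanReceive (E.first m') y) :
    t < numErrors (E.first m) y + numErrors (E.second m y) (E.second m' y) ∨
    t < numErrors (E.first m') y + numErrors (E.second m' y) (E.second m y) := by
  by_contra! hc
  obtain ⟨dec, hdec⟩ := hE
  refine hm ((hdec m y (E.second m y ⊓ E.second m' y) ⟨h, canReceive_inf_left _ _, ?_⟩).symm.trans
    (hdec m' y (E.second m y ⊓ E.second m' y) ⟨h', canReceive_inf_right _ _, ?_⟩))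
  · rw [numErrors_inf_left]; exact hc.1
  · rw [numErrors_inf_right]; exact hc.2

lemma corrects_of_forall_lt_or_lt [NeZero M]
    (hE : ∀ m m' : Fin M, m ≠ m' → ∀ y, CanReceive (E.first m) y → CanReceive (E.first m') y →
      t < numErrors (E.first m) y + numErrors (E.second m y) (E.second m' y) ∨
      t < numErrors (E.first m') y + numErrors (E.second m' y) (E.second m y)) :
    E.Corrects t := by
  have hunique : ∀ y₁ y₂ m m', E.IsOutput t m y₁ y₂ → E.IsOutput t m' y₁ y₂ → m = m' := by
    rintro y₁ y₂ m m' ⟨h₁, h₂, ht⟩ ⟨h₁', h₂', ht'⟩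
    by_contra hne
    have := h₂'.numErrors_le (E.second m y₁)
    have := h₂.numErrors_le (E.second m' y₁)
    rcases hE m m' hne y₁ h₁ h₁' with h | h <;> omega
  have hdec : ∀ y : Word n₁ × Word n₂, ∃ m', ∀ m, E.IsOutput t m y.1 y.2 → m' = m := by
    intro y
    by_cases h : ∃ m, E.IsOutput t m y.1 y.2
    · exact h.imp fun m' hm' m hm => hunique _ _ _ _ hm' hm
    · exact ⟨0, fun m hm => absurd ⟨m, hm⟩ h⟩
  choose dec hdec using hdec
  exact ⟨fun y₁ y₂ => dec (y₁, y₂), fun m y₁ y₂ => hdec (y₁, y₂) m⟩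

end TwoStageEncoder

/-! ### The converse bound -/

lemma exists_large_subset_card_ones_close {α : Type*} {n D B : ℕ} (c : α → Word n)
    (hD : 0 < D) {S : Finset α} (hS : (D + 1) * B < #S) :
    ∃ S' ⊆ S, B < #S' ∧ ∃ ω ∈ Set.Icc (0 : ℝ) 1, ∀ a ∈ S',
      ω * n ≤ #(ones (c a)) ∧ #(ones (c a)) ≤ (ω + 1 / D) * n := by
  have hD' : (0 : ℝ) < D := by exact_mod_cast hD
  let v : α → ℝ := fun a => #(ones (c a)) / n
  have hv : ∀ a, v a * n = #(ones (c a)) := fun a =>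
    div_mul_cancel_of_imp fun h => by
      have := card_ones_le (c a)
      norm_cast at h ⊢
      lia
  have hv₁ : ∀ a, v a ≤ 1 := fun a =>
    div_le_one_of_le₀ (by exact_mod_cast card_ones_le (c a)) n.cast_nonneg
  have hmaps : ∀ a ∈ S, ⌊v a * D⌋₊ ∈ range (D + 1) := fun a _ =>
    mem_range_succ_iff.2 (Nat.floor_le_of_le (mul_le_of_le_one_left hD'.le (hv₁ a)))
  obtain ⟨j, hj, hcard⟩ := exists_lt_card_fiber_of_mul_lt_card_of_maps_to hmaps
    (by simpa using hS)
  have hjD : (j : ℝ) ≤ D := by exact_mod_cast mem_range_succ_iff.1 hj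
  refine ⟨_, filter_subset _ _, hcard, j / D, ⟨by positivity, (div_le_one hD').2 hjD⟩, ?_⟩
  intro a ha
  rw [← (mem_filter.1 ha).2, ← hv, ← add_div]
  constructor <;> gcongr
  · rw [div_le_iff₀ hD']
    exact Nat.floor_le (by positivity)
  · rw [le_div_iff₀ hD']
    exact (Nat.lt_floor_add_one _).le

lemma sum_numErrors_eq_sum_card_mul_card {α : Type*} (S : Finset α) {n : ℕ} (c : α → Word n) :
    ∑ a ∈ S, ∑ b ∈ S, numErrors (c a) (c b) =
      ∑ i, #{a ∈ S | c a i = true} * #{b ∈ S | c b i = false} := by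
  simp only [numErrors, card_filter, sum_mul_sum, ite_zero_mul_ite_zero, mul_one]
  exact (sum_congr rfl fun a _ => sum_comm).trans sum_comm

lemma four_mul_sum_numErrors_le {α : Type*} (S : Finset α) {n : ℕ} (c : α → Word n) :
    4 * ∑ a ∈ S, ∑ b ∈ S, numErrors (c a) (c b) ≤ n * #S ^ 2 := by
  rw [sum_numErrors_eq_sum_card_mul_card, mul_sum]
  calc ∑ i, 4 * (#{a ∈ S | c a i = true} * #{b ∈ S | c b i = false})
      ≤ ∑ _i : Fin n, #S ^ 2 := by
        refine sum_le_sum fun i _ => ?_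
        rw [← card_filter_add_card_filter_not (s := S) (fun a => c a i = true), ← mul_assoc]
        simpa only [Bool.not_eq_true] using four_mul_le_sq_add _ _
    _ = n * #S ^ 2 := by simp

lemma four_mul_card_sub_one_mul_le {α : Type*} {S : Finset α} (hS : S.Nonempty) {n : ℕ}
    {c : α → Word n} {s : ℝ} (hs : ∀ a ∈ S, ∀ b ∈ S, a ≠ b → s ≤ numErrors (c a) (c b)) :
    4 * (#S - 1) * s ≤ n * #S := by
  classical
  have hpos : (0 : ℝ) < #S := by exact_mod_cast hS.card_pos
  have hsum : (#S - 1) * #S * s ≤ ∑ a ∈ S, ∑ b ∈ S, (numErrors (c a) (c b) : ℝ) := by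
    calc ((#S : ℝ) - 1) * #S * s = ∑ _p ∈ S.offDiag, s := by
          rw [sum_const, offDiag_card, nsmul_eq_mul, Nat.cast_sub (Nat.le_mul_self _)]
          push_cast
          ring
      _ ≤ ∑ p ∈ S.offDiag, (numErrors (c p.1) (c p.2) : ℝ) := by
          refine sum_le_sum fun p hp => ?_
          obtain ⟨h₁, h₂, hne⟩ := mem_offDiag.1 hp
          exact hs _ h₁ _ h₂ hne
      _ ≤ ∑ p ∈ S ×ˢ S, (numErrors (c p.1) (c p.2) : ℝ) :=
          sum_le_sum_of_subset_of_nonneg (by grind) fun _ _ _ => Nat.cast_nonneg _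
      _ = ∑ a ∈ S, ∑ b ∈ S, (numErrors (c a) (c b) : ℝ) := sum_product _ _ _
  have hplotkin : 4 * ∑ a ∈ S, ∑ b ∈ S, (numErrors (c a) (c b) : ℝ) ≤ n * (#S : ℝ) ^ 2 := by
    exact_mod_cast four_mul_sum_numErrors_le S c
  refine le_of_mul_le_mul_right ?_ hpos
  linarith

lemma le_quarter_of_card_ones_close {α : Type*} {S : Finset α} {n D : ℕ} {c : α → Word n}
    (hD : 0 < D) (hS : 3 * D < #S) {ω s : ℝ}
    (hω : ∀ a ∈ S, ω * n ≤ #(ones (c a)) ∧ #(ones (c a)) ≤ (ω + 1 / D) * n)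
    (hs : ∀ a ∈ S, ∀ b ∈ S, a ≠ b → s ≤ numErrors (c a) (c b) ∨ s ≤ numErrors (c b) (c a)) :
    s ≤ n / 4 + 2 * (n / D) := by
  have hD' : (1 : ℝ) ≤ D := by exact_mod_cast hD
  have hB : 3 * (D : ℝ) + 1 ≤ #S := by exact_mod_cast hS
  have hnD : (0 : ℝ) ≤ n / D := by positivity
  have horiented : ∀ a ∈ S, ∀ b ∈ S, a ≠ b → s - n / D ≤ numErrors (c a) (c b) := by
    intro a ha b hb hab
    have hcomm : (numErrors (c a) (c b) : ℝ) + #(ones (c b))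
        = numErrors (c b) (c a) + #(ones (c a)) := by
      exact_mod_cast numErrors_add_card_ones_comm (c a) (c b)
    have hclose : (ω + 1 / D) * n = ω * n + n / D := by ring
    rcases hs a ha b hb hab with h | h <;> linarith [(hω a ha).1, (hω b hb).2]
  have hplotkin := four_mul_card_sub_one_mul_le (card_pos.1 (by lia)) horiented
  have hn : (n : ℝ) ≤ n / D * (#S - 1) := by
    calc (n : ℝ) = n / D * D := by field_simp
      _ ≤ n / D * (#S - 1) := by gcongr; linarith
  refine le_of_mul_le_mul_left (a := 4 * ((#S : ℝ) - 1)) ?_ (by linarith)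
  linarith

lemma pow_succ_le_descFactorial_add (k r : ℕ) :
    k ^ (r + 1) ≤ k.descFactorial (r + 1) + (r + 1) ^ 2 * k ^ r := by
  induction r with
  | zero => simp
  | succ r ih =>
    have hsub : k * k.descFactorial (r + 1) ≤
        (k - (r + 1)) * k.descFactorial (r + 1) + (r + 1) * k.descFactorial (r + 1) := by
      rw [← add_mul]
      gcongr
      lia
    have hdesc : k.descFactorial (r + 1) ≤ k ^ (r + 1) := Nat.descFactorial_le_pow k (r + 1)
    calc k ^ (r + 1 + 1) = k * k ^ (r + 1) := pow_succ' _ _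
      _ ≤ k * (k.descFactorial (r + 1) + (r + 1) ^ 2 * k ^ r) := by gcongr
      _ ≤ k.descFactorial (r + 1 + 1) + (r + 1 + 1) ^ 2 * k ^ (r + 1) := by
        rw [Nat.descFactorial_succ k (r + 1)]
        nlinarith [pow_succ' k r]

section Intersection

variable {α ι : Type*} [Fintype ι] [DecidableEq ι]

lemma sum_card_inf_powersetCard (S : Finset α) (A : α → Finset ι) (r : ℕ) :
    ∑ T ∈ S.powersetCard r, #(T.inf A) = ∑ i, (#{a ∈ S | i ∈ A a}).choose r := by
  have hcount := sum_card_bipartiteAbove_eq_sum_card_bipartiteBelow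
    (s := S.powersetCard r) (t := univ) fun T i => i ∈ T.inf A
  convert hcount using 2 with T - i -
  · congr 1
    ext i
    simp [bipartiteAbove]
  · rw [← card_powersetCard]
    congr 1
    ext T
    simp only [bipartiteBelow, mem_filter, mem_powersetCard, mem_inf, subset_iff]
    grind

lemma sum_pow_succ_le_factorial_mul_sum_card_inf_add (S : Finset α) (A : α → Finset ι) (r : ℕ) :
    ∑ i, #{a ∈ S | i ∈ A a} ^ (r + 1) ≤
      (r + 1).factorial * ∑ T ∈ S.powersetCard (r + 1), #(T.inf A)
        + (r + 1) ^ 2 * (Fintype.card ι * #S ^ r) := by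
  calc ∑ i, #{a ∈ S | i ∈ A a} ^ (r + 1)
      ≤ ∑ i, ((r + 1).factorial * (#{a ∈ S | i ∈ A a}).choose (r + 1)
          + (r + 1) ^ 2 * #S ^ r) := by
        refine sum_le_sum fun i _ => (pow_succ_le_descFactorial_add _ r).trans ?_
        rw [Nat.descFactorial_eq_factorial_mul_choose]
        gcongr
        exact filter_subset _ _
    _ = _ := by
        rw [sum_card_inf_powersetCard, sum_add_distrib, ← mul_sum, sum_const, card_univ,
          smul_eq_mul]
        ring

lemma mul_pow_le_factorial_mul_sum_card_inf [Nonempty ι] {S : Finset α} (hS : S.Nonempty)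
    {A : α → Finset ι} (r : ℕ) {ω : ℝ} (hω : 0 ≤ ω)
    (hA : ∀ a ∈ S, ω * Fintype.card ι ≤ #(A a)) :
    (ω ^ (r + 1) - (r + 1) ^ 2 / #S) * Fintype.card ι * #S ^ (r + 1) ≤
      (r + 1).factorial * ∑ T ∈ S.powersetCard (r + 1), (#(T.inf A) : ℝ) := by
  set N : ℝ := (Fintype.card ι : ℝ)
  have hN : 0 < N := Nat.cast_pos.2 Fintype.card_pos
  have : (0 : ℝ) < #S := by exact_mod_cast hS.card_pos
  let k : ι → ℕ := fun i => #{a ∈ S | i ∈ A a}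
  have hmass : ω * N * #S ≤ ∑ i, (k i : ℝ) := by
    calc ω * N * #S = ∑ _a ∈ S, ω * N := by rw [sum_const, nsmul_eq_mul, mul_comm]
      _ ≤ ∑ a ∈ S, (#(A a) : ℝ) := sum_le_sum hA
      _ = ∑ i, (k i : ℝ) := by
        norm_cast
        simpa [bipartiteAbove, bipartiteBelow] using
          sum_card_bipartiteAbove_eq_sum_card_bipartiteBelow (s := S) (t := univ) fun a i => i ∈ A a
  have hmean : ω ^ (r + 1) * N * #S ^ (r + 1) ≤ ∑ i, (k i : ℝ) ^ (r + 1) := by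
    calc ω ^ (r + 1) * N * #S ^ (r + 1) = (ω * N * #S) ^ (r + 1) / N ^ r := by
          field_simp
          ring
      _ ≤ (∑ i, (k i : ℝ)) ^ (r + 1) / N ^ r := by gcongr
      _ ≤ ∑ i, (k i : ℝ) ^ (r + 1) :=
          pow_sum_div_card_le_sum_pow (s := univ) (fun i _ => (k i).cast_nonneg) r
  have hupper : ∑ i, (k i : ℝ) ^ (r + 1) ≤
      (r + 1).factorial * ∑ T ∈ S.powersetCard (r + 1), (#(T.inf A) : ℝ)
        + (r + 1) ^ 2 * (N * #S ^ r) := by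
    have hcount := (Nat.cast_le (α := ℝ)).2 (sum_pow_succ_le_factorial_mul_sum_card_inf_add S A r)
    push_cast at hcount
    exact hcount
  calc (ω ^ (r + 1) - (r + 1) ^ 2 / #S) * N * #S ^ (r + 1)
      = ω ^ (r + 1) * N * #S ^ (r + 1) - (r + 1) ^ 2 * (N * #S ^ r) := by
        field_simp
        ring
    _ ≤ _ := by linarith

lemma exists_mem_powersetCard_le_card_inf [Nonempty ι] {S : Finset α} {A : α → Finset ι} {r : ℕ}
    (hr : r + 1 ≤ #S) {ω : ℝ} (hω : 0 ≤ ω) (hA : ∀ a ∈ S, ω * Fintype.card ι ≤ #(A a)) :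
    ∃ T ∈ S.powersetCard (r + 1),
      (ω ^ (r + 1) - (r + 1) ^ 2 / #S) * Fintype.card ι ≤ #(T.inf A) := by
  set θ : ℝ := ω ^ (r + 1) - (r + 1) ^ 2 / #S
  have hne : (S.powersetCard (r + 1)).Nonempty := powersetCard_nonempty.2 hr
  rcases le_total θ 0 with hθ | hθ
  · exact hne.imp fun T hT => ⟨hT, (mul_nonpos_of_nonpos_of_nonneg hθ (Nat.cast_nonneg _)).trans
      (Nat.cast_nonneg _)⟩
  refine exists_le_of_sum_le hne ?_
  refine le_of_mul_le_mul_left ?_ (by positivity : (0 : ℝ) < (r + 1).factorial)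
  calc ((r + 1).factorial : ℝ) * ∑ _T ∈ S.powersetCard (r + 1), θ * Fintype.card ι
      = θ * Fintype.card ι * (#S).descFactorial (r + 1) := by
        rw [sum_const, card_powersetCard, Nat.descFactorial_eq_factorial_mul_choose, nsmul_eq_mul]
        push_cast
        ring
    _ ≤ θ * Fintype.card ι * #S ^ (r + 1) := by
        gcongr
        exact_mod_cast Nat.descFactorial_le_pow _ _
    _ ≤ _ := mul_pow_le_factorial_mul_sum_card_inf (card_pos.1 (by lia)) r hω hA

end Intersection

lemma ones_finset_inf {α : Type*} {n : ℕ} (T : Finset α) (c : α → Word n) :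
    ones (T.inf c) = T.inf fun a => ones (c a) := by
  classical
  induction T using Finset.induction_on with
  | empty => ext; simp
  | insert a T _ ih => simp [ones_inf, ih, Finset.inf_eq_inter]

lemma exists_pair_numErrors_le_half {α : Type*} {T : Finset α} (hT : 2 < #T) {n : ℕ}
    (c : α → Word n) : ∃ a ∈ T, ∃ b ∈ T, a ≠ b ∧
      2 * numErrors (c a) (c b) ≤ n ∧ 2 * numErrors (c b) (c a) ≤ n := by
  obtain ⟨x, y, z, hx, hy, hz, hxy, hxz, hyz⟩ := two_lt_card_iff.1 hT
  by_contra! hcon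
  have := hcon x hx y hy hxy
  have := hcon y hy z hz hyz
  have := hcon x hx z hz hxz
  have := numErrors_add_numErrors_le (c x) (c y) (c z)
  have := numErrors_add_numErrors_le (c x) (c z) (c y)
  have := numErrors_add_numErrors_le (c y) (c x) (c z)
  have := numErrors_add_numErrors_le (c y) (c z) (c x)
  have := numErrors_add_numErrors_le (c z) (c x) (c y)
  have := numErrors_add_numErrors_le (c z) (c y) (c x)
  lia

namespace TwoStageEncoder.Corrects

variable {n₁ n₂ M t : ℕ} {E : TwoStageEncoder n₁ n₂ M}

lemma sub_le_or_sub_le (hE : E.Corrects t) {m m' : Fin M} (hm : m ≠ m') {y : Word n₁}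
    (h : CanReceive (E.first m) y) (h' : CanReceive (E.first m') y) {W : ℝ}
    (hW : numErrors (E.first m) y ≤ W) (hW' : numErrors (E.first m') y ≤ W) :
    t - W ≤ numErrors (E.second m y) (E.second m' y) ∨
    t - W ≤ numErrors (E.second m' y) (E.second m y) := by
  refine (hE.lt_or_lt hm h h').imp (fun hlt => ?_) fun hlt => ?_
  all_goals
    have := (Nat.cast_le (α := ℝ)).2 hlt.le
    push_cast at this
    linarith

lemma le_of_erase_first (hE : E.Corrects t) {S : Finset (Fin M)} {D : ℕ} (hD : 0 < D)
    (hS : (D + 1) * (3 * D) < #S) {W : ℝ} (hW : ∀ m ∈ S, #(ones (E.first m)) ≤ W) :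
    t ≤ W + n₂ / 4 + 2 * (n₂ / D) := by
  have hreceive : ∀ x : Word n₁, CanReceive x ⊥ := fun x => by simpa using canReceive_inf_right ⊥ x
  have herrors : ∀ m ∈ S, numErrors (E.first m) ⊥ ≤ W := fun m hm => by
    have hweight := (hreceive (E.first m)).numErrors_add_card_ones
    exact (Nat.cast_le.2 (by lia)).trans (hW m hm)
  obtain ⟨S', hS', hcard, ω, -, hω⟩ :=
    exists_large_subset_card_ones_close (fun m => E.second m ⊥) hD hS
  have hquarter := le_quarter_of_card_ones_close hD hcard hω fun a ha b hb hab =>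
    hE.sub_le_or_sub_le hab (hreceive _) (hreceive _) (herrors a (hS' ha)) (herrors b (hS' hb))
  linarith

lemma le_of_common_support (hE : E.Corrects t) (hn₁ : 0 < n₁) {S : Finset (Fin M)}
    (hS : 3 ≤ #S) {ω W : ℝ} (hω : 0 ≤ ω)
    (hW : ∀ m ∈ S, ω * n₁ ≤ #(ones (E.first m)) ∧ #(ones (E.first m)) ≤ W) :
    t ≤ W - (ω ^ 3 - 9 / #S) * n₁ + n₂ / 2 := by
  have : NeZero n₁ := ⟨hn₁.ne'⟩
  obtain ⟨T, hT, hinf⟩ := exists_mem_powersetCard_le_card_inf (r := 2) hS hω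
    (A := fun m => ones (E.first m)) (by simpa using fun m hm => (hW m hm).1)
  obtain ⟨hTS, hT⟩ := mem_powersetCard.1 hT
  rw [← ones_finset_inf, Fintype.card_fin] at hinf
  norm_num at hinf
  have hreceive : ∀ m ∈ T, CanReceive (E.first m) (T.inf E.first) := fun m hm => by
    rw [canReceive_iff_ones_subset, ones_finset_inf]
    exact inf_le hm
  have herrors : ∀ m ∈ T, numErrors (E.first m) (T.inf E.first) ≤
      W - (ω ^ 3 - 9 / #S) * n₁ := fun m hm => by
    have hsum := (hreceive m hm).numErrors_add_card_ones
    have hle := (hW m (hTS hm)).2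
    rw [← hsum] at hle
    push_cast at hle
    linarith
  obtain ⟨a, ha, b, hb, hab, hhalf, hhalf'⟩ :=
    exists_pair_numErrors_le_half (by lia : 2 < #T) fun m => E.second m (T.inf E.first)
  have := (Nat.cast_le (α := ℝ)).2 hhalf
  have := (Nat.cast_le (α := ℝ)).2 hhalf'
  push_cast at *
  rcases hE.sub_le_or_sub_le hab (hreceive a ha) (hreceive b hb) (herrors a ha) (herrors b hb)
    with h | h <;> linarith

lemma le_tauMax_mul_add (hE : E.Corrects t) (hn₁ : 0 < n₁) {D : ℕ} (hD : 0 < D)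
    (hM : (D + 1) * ((D + 1) * (9 * D)) < M) :
    (t : ℝ) ≤ (tauMax + 2 / D) * (n₁ + n₂) := by
  obtain ⟨S, -, hS, ω, hω, hweight⟩ :=
    exists_large_subset_card_ones_close (S := univ) E.first hD (by simpa using hM)
  have hS₉ : 9 * D < #S := (Nat.le_mul_of_pos_left _ D.succ_pos).trans_lt hS
  have hD' : (0 : ℝ) < D := by exact_mod_cast hD
  have herase := hE.le_of_erase_first hD (by lia) fun m hm => (hweight m hm).2
  have hcommon := hE.le_of_common_support hn₁ (by lia) hω.1 hweight
  have hsmall : 9 / (#S : ℝ) ≤ 1 / D := by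
    rw [div_le_div_iff₀ (by exact_mod_cast (by lia : 0 < #S)) hD', one_mul]
    exact_mod_cast hS₉.le
  have hsmall' := mul_le_mul_of_nonneg_right hsmall n₁.cast_nonneg
  have hslack : (0 : ℝ) ≤ n₁ / D ∧ (0 : ℝ) ≤ n₂ / D := by constructor <;> positivity
  have := le_tauMax_mul (s := t - 2 / D * (n₁ + n₂)) hω.2 n₁.cast_nonneg n₂.cast_nonneg
    (by linear_combination herase + hslack.1)
    (by linear_combination hcommon + hsmall' + 2 * hslack.2)
  linarith

end TwoStageEncoder.Corrects

lemma one_le_maxMessages {n : ℕ} (hn : 3 ≤ n) (t : ℕ) : 1 ≤ maxMessages n t :=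
  (isGreatest_maxMessages hn t).2 (transmittable_one hn t)

lemma exists_eventually_maxMessages_le {τ : ℝ} (hτ : tauMax < τ) :
    ∃ C : ℕ, ∀ᶠ n : ℕ in atTop, maxMessages n ⌊τ * n⌋₊ ≤ C := by
  obtain ⟨D, hD⟩ := exists_nat_gt (4 / (τ - tauMax))
  have hgap : 0 < τ - tauMax := sub_pos.2 hτ
  have hD₀ : (0 : ℝ) < D := lt_trans (by positivity) hD
  rw [div_lt_iff₀ hgap, ← div_lt_iff₀' hD₀] at hD
  refine ⟨(D + 1) * ((D + 1) * (9 * D)), ?_⟩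
  filter_upwards [eventually_ge_atTop 3, eventually_ge_atTop D] with n hn hnD
  obtain ⟨n₁, n₂, hn₁, -, rfl, E, hE⟩ := (isGreatest_maxMessages hn ⌊τ * n⌋₊).1
  by_contra! hcon
  have hle := hE.le_tauMax_mul_add (by lia) (by exact_mod_cast hD₀) hcon
  have hfloor := Nat.lt_floor_add_one (τ * (n₁ + n₂ : ℕ))
  have hlarge : (D : ℝ) ≤ (n₁ + n₂ : ℕ) := by exact_mod_cast hnD
  have hgain : 2 / D * D < (τ - tauMax - 2 / D) * (n₁ + n₂ : ℕ) := by
    rw [show (4 : ℝ) / D = 2 / D + 2 / D by ring] at hD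
    have : (0 : ℝ) < 2 / D := by positivity
    nlinarith
  rw [div_mul_cancel₀ _ hD₀.ne'] at hgain
  push_cast at *
  linarith

lemma rate_eq_zero {τ : ℝ} (hτ : tauMax < τ) : rate τ = 0 := by
  obtain ⟨C, hC⟩ := exists_eventually_maxMessages_le hτ
  refine (tendsto_of_tendsto_of_tendsto_of_le_of_le' tendsto_const_nhds
    (tendsto_const_div_atTop_nhds_zero_nat (Real.logb 2 C)) ?_ ?_).limsup_eq
  all_goals filter_upwards [eventually_ge_atTop 3, hC] with n hn hle
  all_goals
    have hone : (1 : ℝ) ≤ maxMessages n ⌊τ * n⌋₊ := by exact_mod_cast one_le_maxMessages hn _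
  · have := Real.logb_nonneg one_lt_two hone
    positivity
  · gcongr
    exact one_lt_two

/-! ### Random codes -/

/-- Changing any `k ≤ L` of the words `c m` into a common word takes at least `r k` errors in each
of them. This is what the second stage gains from knowing the output of the first: a long list of
candidates is possible only after many errors. -/
def HasListRadius {ι : Type*} {n : ℕ} (c : ι → Word n) (L : ℕ) (r : ℕ → ℝ) : Prop :=
  ∀ S : Finset ι, #S ≤ L → ∀ y, (∀ m ∈ S, CanReceive (c m) y) →
    ∀ m ∈ S, r #S ≤ numErrors (c m) y

section Random

open MeasureTheory ProbabilityTheory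
open scoped unitInterval

variable {Ω : Type*} [MeasurableSpace Ω] {P : Measure Ω} [IsProbabilityMeasure P]

lemma measureReal_pi_sum_le_le_exp {X : Ω → ℝ} (hX : Measurable X)
    (hX₀₁ : ∀ ω, X ω ∈ Set.Icc 0 1) {ε : ℝ} (hε : 0 ≤ ε) (n : ℕ) :
    (Measure.pi fun _ : Fin n => P).real {s | ∑ i, X (s i) ≤ (P[X] - ε) * n} ≤
      Real.exp (-(2 * ε ^ 2 * n)) := by
  have hindep : iIndepFun (fun (i : Fin n) s => -(X (s i) - P[X])) (Measure.pi fun _ => P) :=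
    iIndepFun_pi fun _ => (hX.sub_const _).neg.aemeasurable
  have hsubG : ∀ i ∈ (univ : Finset (Fin n)), HasSubgaussianMGF (fun s => -(X (s i) - P[X]))
      ((‖(1 : ℝ) - 0‖₊ / 2) ^ 2) (Measure.pi fun _ => P) := by
    intro i _
    have heval : MeasurePreserving (fun s : Fin n → Ω => s i) (Measure.pi fun _ => P) P :=
      measurePreserving_eval _ i
    have h : HasSubgaussianMGF (fun ω => X ω - P[X]) ((‖(1 : ℝ) - 0‖₊ / 2) ^ 2)
        ((Measure.pi fun _ => P).map fun s : Fin n → Ω => s i) := by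
      rw [heval.map_eq]
      exact hasSubgaussianMGF_of_mem_Icc hX.aemeasurable (ae_of_all P hX₀₁)
    exact (h.of_map heval.aemeasurable).neg
  have hhoeffding := HasSubgaussianMGF.measure_sum_ge_le_of_iIndepFun hindep hsubG
    (by positivity : 0 ≤ ε * n)
  convert hhoeffding using 2
  · congr 1
    ext s
    simp only [neg_sub, sum_sub_distrib, sum_const, card_univ, Fintype.card_fin,
      nsmul_eq_mul]
    constructor <;> intro h <;> linarith
  · rcases n.eq_zero_or_pos with rfl | hn
    · simp
    · norm_num
      field_simp
      ring

lemma exists_forall_lt_sum {κ : Type*} [Fintype κ] {X : κ → Ω → ℝ} (hX : ∀ k, Measurable (X k))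
    (hX₀₁ : ∀ k ω, X k ω ∈ Set.Icc 0 1) {ε : ℝ} (hε : 0 ≤ ε) {n : ℕ}
    (hκ : Fintype.card κ < Real.exp (2 * ε ^ 2 * n)) :
    ∃ s : Fin n → Ω, ∀ k, (P[X k] - ε) * n < ∑ i, X k (s i) := by
  by_contra! hcon
  have hcover : (⋃ k, {s : Fin n → Ω | ∑ i, X k (s i) ≤ (P[X k] - ε) * n}) = Set.univ := by
    ext s
    simpa using hcon s
  have hunion := calc
    (1 : ℝ) = (Measure.pi fun _ : Fin n => P).real
        (⋃ k, {s | ∑ i, X k (s i) ≤ (P[X k] - ε) * n}) := by rw [hcover, probReal_univ]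
    _ ≤ ∑ k, (Measure.pi fun _ : Fin n => P).real {s | ∑ i, X k (s i) ≤ (P[X k] - ε) * n} :=
        measureReal_iUnion_fintype_le _
    _ ≤ ∑ _k : κ, Real.exp (-(2 * ε ^ 2 * n)) :=
        sum_le_sum fun k _ => measureReal_pi_sum_le_le_exp (hX k) (hX₀₁ k) hε n
    _ = Fintype.card κ / Real.exp (2 * ε ^ 2 * n) := by
        rw [sum_const, nsmul_eq_mul, card_univ, Real.exp_neg, div_eq_mul_inv]
  rw [le_div_iff₀ (Real.exp_pos _)] at hunion
  linarith

lemma exists_image_eq_of_card_le {α : Type*} [DecidableEq α] {S : Finset α} (hS : S.Nonempty)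
    {L : ℕ} (hL : #S ≤ L) : ∃ f : Fin L → α, univ.image f = S := by
  have : Nonempty S := hS.to_subtype
  obtain ⟨e⟩ := Function.Embedding.nonempty_of_card_le (α := S) (β := Fin L) (by simpa using hL)
  refine ⟨fun j => (Function.invFun e j : S), ?_⟩
  ext a
  simp only [mem_image, mem_univ, true_and]
  refine ⟨fun ⟨j, hj⟩ => hj ▸ Subtype.prop _, fun ha => ?_⟩
  exact (Function.invFun_surjective e.injective ⟨a, ha⟩).imp fun j hj => congrArg Subtype.val hj

variable {ι : Type*} [Fintype ι]

lemma measureReal_pi_bernoulli_forall_mem (w : I) (S : Finset ι) :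
    (Measure.pi fun _ : ι => Ber(true, false, w)).real {a | ∀ m ∈ S, a m = true} = w ^ #S := by
  classical
  have hpi : {a : ι → Bool | ∀ m ∈ S, a m = true} =
      Set.pi Set.univ fun m => if m ∈ S then {true} else Set.univ := by
    ext a
    simp only [Set.mem_ofPred_eq, Set.mem_pi, Set.mem_univ, true_implies]
    exact forall_congr' fun m => by split_ifs with h <;> simp [h]
  have hfactor : ∀ m : ι, (Ber(true, false, w) (if m ∈ S then {true} else Set.univ)).toReal =
      if m ∈ S then (w : ℝ) else 1 := by
    intro m
    rw [← measureReal_def]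
    split_ifs
    · exact bernoulliMeasure_real_apply_of_mem_of_notMem w .of_discrete rfl (by simp)
    · exact probReal_univ
  rw [hpi, measureReal_def, Measure.pi_pi, ENNReal.toReal_prod]
  simp_rw [hfactor]
  rw [prod_ite_mem, univ_inter, prod_const]

lemma measureReal_pi_bernoulli_diff (w : I) {S : Finset ι} {m : ι} (hm : m ∈ S) :
    (Measure.pi fun _ : ι => Ber(true, false, w)).real
      {a | a m = true ∧ ¬ ∀ m' ∈ S, a m' = true} = w - w ^ #S := by
  have hsub : {a : ι → Bool | ∀ m' ∈ S, a m' = true} ⊆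
      {a | ∀ m' ∈ ({m} : Finset ι), a m' = true} := fun a ha => by simpa using ha m hm
  have hdiff : {a : ι → Bool | a m = true ∧ ¬ ∀ m' ∈ S, a m' = true} =
      {a | ∀ m' ∈ ({m} : Finset ι), a m' = true} \ {a | ∀ m' ∈ S, a m' = true} := by
    ext a
    simp
  rw [hdiff, measureReal_sdiff hsub .of_discrete, measureReal_pi_bernoulli_forall_mem,
    measureReal_pi_bernoulli_forall_mem, card_singleton, pow_one]

lemma exists_hasListRadius {n L : ℕ} (w : I) {ε : ℝ} (hε : 0 ≤ ε)
    (hn : (Fintype.card ι : ℝ) ^ (L + 1) < Real.exp (2 * ε ^ 2 * n)) :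
    ∃ c : ι → Word n, HasListRadius c L fun k => (w - w ^ k - ε) * n := by
  classical
  -- An error must occur in the word `m` wherever it carries a one and some word of `S` does not;
  -- a random position is of this kind with probability `w - w ^ #S`.
  let A : ι × (Fin L → ι) → Set (ι → Bool) := fun k =>
    {a | a k.1 = true ∧ ¬ ∀ m' ∈ univ.image k.2, a m' = true}
  obtain ⟨s, hs⟩ := exists_forall_lt_sum (P := Measure.pi fun _ : ι => Ber(true, false, w))
    (X := fun k => (A k).indicator 1) (n := n) (fun k => .of_discrete)
    (fun k a => by by_cases h : a ∈ A k <;> simp [h]) hε (by simpa [pow_succ'] using hn)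
  refine ⟨fun m i => s i m, fun S hS y hy m hm => ?_⟩
  obtain ⟨f, rfl⟩ := exists_image_eq_of_card_le ⟨m, hm⟩ hS
  have hlt := hs (m, f)
  rw [integral_indicator_one .of_discrete, measureReal_pi_bernoulli_diff w hm] at hlt
  refine hlt.le.trans ?_
  simp only [Set.indicator_apply, Pi.one_apply]
  rw [sum_boole, numErrors]
  gcongr with i
  rintro ⟨him, hi⟩
  obtain ⟨m', hm', him'⟩ := not_forall₂.1 hi
  exact ⟨him, Bool.eq_false_iff.2 fun h => him' (hy m' hm' i h)⟩

end Random

/-! ### Codes with few words -/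

/-- There are `L` words of length `N` such that, for any two of them, changing one into a word that
the other can also become takes `d` errors, at least for one choice of the two. Such a code corrects
any number of errors less than `d`. -/
def HasCode (L N : ℕ) (d : ℝ) : Prop :=
  ∃ c : Fin L → Word N, ∀ i j, i ≠ j → d ≤ numErrors (c i) (c j) ∨ d ≤ numErrors (c j) (c i)

section FewWords

variable {L L' N k : ℕ} {d : ℝ}

lemma HasCode.mono (h : HasCode L N d) (hL : L' ≤ L) : HasCode L' N d := by
  obtain ⟨c, hc⟩ := h
  exact ⟨fun i => c (Fin.castLE hL i), fun i j hij => hc _ _ ((Fin.castLE_injective hL).ne hij)⟩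

lemma HasCode.mono_dist {d' : ℝ} (h : HasCode L N d) (hd : d' ≤ d) : HasCode L N d' := by
  obtain ⟨c, hc⟩ := h
  exact ⟨c, fun i j hij => (hc i j hij).imp hd.trans hd.trans⟩

lemma HasCode.exists_words (h : HasCode L N d) {α : Type*} {S : Finset α} (hS : #S ≤ L) :
    ∃ g : α → Word N, ∀ a ∈ S, ∀ b ∈ S, a ≠ b →
      d ≤ numErrors (g a) (g b) ∨ d ≤ numErrors (g b) (g a) := by
  obtain ⟨c, hc⟩ := h
  obtain ⟨e⟩ := Function.Embedding.nonempty_of_card_le (α := S) (β := Fin L) (by simpa using hS)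
  refine ⟨Function.extend Subtype.val (c ∘ e) ⊥, fun a ha b hb hab => ?_⟩
  have hg : ∀ a (ha : a ∈ S), Function.extend Subtype.val (c ∘ e) ⊥ a = c (e ⟨a, ha⟩) :=
    fun a ha => Subtype.val_injective.extend_apply (c ∘ e) ⊥ ⟨a, ha⟩
  rw [hg a ha, hg b hb]
  exact hc _ _ (e.injective.ne (by simpa using hab))

lemma hasCode_of_card_le {α ι : Type*} [Fintype ι] [DecidableEq ι] [Fintype α] (c : α → Finset ι)
    (hc : ∀ a b, a ≠ b → d ≤ #(c a \ c b) ∨ d ≤ #(c b \ c a))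
    (hL : L ≤ Fintype.card α) (hN : Fintype.card ι ≤ N) : HasCode L N d := by
  obtain ⟨e⟩ := Function.Embedding.nonempty_of_card_le (α := Fin L) (β := α) (by simpa using hL)
  obtain ⟨f⟩ := Function.Embedding.nonempty_of_card_le (α := ι) (β := Fin N) (by simpa using hN)
  have hones : ∀ s : Finset ι, ones (fun l => decide (l ∈ s.map f)) = s.map f := fun s => by
    ext; simp
  refine ⟨fun i l => decide (l ∈ (c (e i)).map f), fun i j hij => ?_⟩
  simp only [numErrors_eq_card_sdiff, hones, ← Finset.map_sdiff, card_map]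
  exact hc _ _ (e.injective.ne hij)

lemma HasCode.repeat (h : HasCode L N d) {n : ℕ} (hn : N * k ≤ n) : HasCode L n (d * k) := by
  obtain ⟨c, hc⟩ := h
  refine hasCode_of_card_le (fun i => ones (c i) ×ˢ (univ : Finset (Fin k))) (fun i j hij => ?_)
    (Fintype.card_fin L).ge (by simpa using hn)
  have hsdiff : ∀ s t : Finset (Fin N),
      #(s ×ˢ univ \ t ×ˢ (univ : Finset (Fin k))) = #(s \ t) * k := fun s t => by
    rw [show s ×ˢ univ \ t ×ˢ univ = (s \ t) ×ˢ univ by ext; simp]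
    simp
  simp only [hsdiff, ← numErrors_eq_card_sdiff, Nat.cast_mul]
  exact (hc i j hij).imp (fun h => by gcongr) fun h => by gcongr

lemma HasCode.eventually (h : HasCode L N d) (hN : 0 < N) (hd : 0 ≤ d) {δ : ℝ} (hδ : δ < d / N) :
    ∀ᶠ n : ℕ in atTop, HasCode L n (δ * n) := by
  have hN' : (0 : ℝ) < N := by exact_mod_cast hN
  have hlarge : Tendsto (fun n : ℕ => (d / N - δ) * (n : ℝ)) atTop atTop :=
    tendsto_natCast_atTop_atTop.const_mul_atTop (sub_pos.2 hδ)
  filter_upwards [hlarge.eventually_ge_atTop d] with n hn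
  refine (h.repeat (Nat.mul_div_le n N)).mono_dist ?_
  have hquot : (n : ℝ) / N ≤ (n / N : ℕ) + 1 := by
    rw [div_le_iff₀' hN']
    exact_mod_cast (Nat.lt_mul_div_succ n hN).le
  calc δ * n ≤ d * (n / N) - d := by linear_combination hn
    _ ≤ d * (n / N : ℕ) := by linear_combination d * hquot

lemma hasCode_card_add_two {α ι : Type*} [Fintype α] [Nontrivial α] [Fintype ι] [DecidableEq ι]
    (c : α → Finset ι) (hc : ∀ a b, a ≠ b → d ≤ #(c a \ c b)) :
    HasCode (Fintype.card α + 2) (Fintype.card ι) d := by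
  have htop : ∀ b, d ≤ #(univ \ c b) := fun b => by
    obtain ⟨a, ha⟩ := exists_ne b
    exact (hc a b ha).trans (by gcongr; exact subset_univ _)
  have hbot : ∀ a, d ≤ #(c a \ ∅) := fun a => by
    obtain ⟨b, hb⟩ := exists_ne a
    exact (hc a b hb.symm).trans (by gcongr; exact empty_subset _)
  have htopbot : d ≤ #(univ \ ∅ : Finset ι) := by
    obtain ⟨b⟩ := Nontrivial.to_nonempty (α := α)
    exact (htop b).trans (by gcongr; exact empty_subset _)
  refine hasCode_of_card_le (α := Option (Option α))
    (fun a => a.elim ∅ fun a => a.elim univ c) ?_ (by simp) le_rfl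
  rintro (_ | _ | a) (_ | _ | b) hab
  all_goals simp only [Option.elim_none, Option.elim_some]
  all_goals grind

lemma card_filter_mem_sdiff_filter_mem {k : ℕ} {i j : Fin (2 * (k + 1))} (hij : i ≠ j) :
    #(univ.filter (fun s : univ.powersetCard (k + 1) => i ∈ s.1) \ univ.filter (j ∈ ·.1)) =
      k.centralBinom := by
  have hcompl : #({i, j}ᶜ : Finset (Fin (2 * (k + 1)))) = 2 * k := by
    rw [card_compl, card_pair hij, Fintype.card_fin]
    lia
  have hwithout : ∀ s, s ∈ powersetCard k {i, j}ᶜ ↔ i ∉ s ∧ j ∉ s ∧ #s = k := fun s => by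
    rw [mem_powersetCard, subset_compl_comm, insert_subset_iff, singleton_subset_iff, mem_compl,
      mem_compl, and_assoc]
  rw [Nat.centralBinom, ← hcompl, ← card_powersetCard, ← card_map (Function.Embedding.subtype _)]
  set F := Finset.map (Function.Embedding.subtype _) _
  have hF : ∀ s, s ∈ F ↔ (i ∈ s ∧ j ∉ s) ∧ #s = k + 1 := by simp [F]
  refine card_nbij' (fun s => s.erase i) (insert i) ?_ ?_ ?_ ?_
  all_goals
    intro s hs
    rw [mem_coe] at hs
    simp only [mem_coe, hwithout, hF] at hs ⊢
    grind

-- The positions are the sets of `k + 1` of `2 (k + 1)` points, and the word of a point marks the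
-- sets that contain it; the words of all ones and of all zeros come on top.
lemma hasCode_centralBinom (k : ℕ) :
    HasCode (2 * k + 4) (k + 1).centralBinom k.centralBinom := by
  have h := hasCode_card_add_two (d := k.centralBinom)
    (fun i : Fin (2 * (k + 1)) => univ.filter fun s : univ.powersetCard (k + 1) => i ∈ s.1)
    fun i j hij => by rw [card_filter_mem_sdiff_filter_mem hij]
  convert h using 1
  · simp; ring
  · simp [Nat.centralBinom]

lemma centralBinom_succ_mul_le {w : ℝ} (hw : 0 ≤ w) {e : ℕ} (he : (2 * k + 1) * w ^ e ≤ 1) :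
    (k + 1).centralBinom * (w ^ 3 + w ^ (e + 3)) ≤ 4 * k.centralBinom * w ^ 3 := by
  have hsucc : ((k : ℝ) + 1) * (k + 1).centralBinom = 2 * (2 * k + 1) * k.centralBinom := by
    exact_mod_cast Nat.succ_mul_centralBinom_succ k
  refine le_of_mul_le_mul_left ?_ (by positivity : (0 : ℝ) < k + 1)
  calc ((k : ℝ) + 1) * ((k + 1).centralBinom * (w ^ 3 + w ^ (e + 3)))
      = 2 * k.centralBinom * w ^ 3 * ((2 * k + 1) + (2 * k + 1) * w ^ e) := by
        rw [← mul_assoc, hsucc]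
        ring
    _ ≤ 2 * k.centralBinom * w ^ 3 * ((2 * k + 1) + 1) := by gcongr
    _ = (k + 1) * (4 * k.centralBinom * w ^ 3) := by ring

lemma succ_mul_pow_le_one {w : ℝ} (hw : w ∈ Set.Icc (0 : ℝ) (2 / 3)) {e : ℕ} (he : 4 ≤ e) :
    (e + 1) * w ^ e ≤ 1 := by
  obtain ⟨h₀, h₁⟩ := hw
  induction e, he using Nat.le_induction with
  | base =>
    have := pow_le_pow_left₀ h₀ h₁ 4
    norm_num at *
    linarith
  | succ e he ih =>
    have he' : (4 : ℝ) ≤ e := by exact_mod_cast he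
    calc ((e + 1 : ℕ) + 1) * w ^ (e + 1) = ((e + 2) * w) * w ^ e := by push_cast; ring
      _ ≤ (e + 1) * w ^ e := by
        gcongr
        nlinarith
      _ ≤ 1 := ih

lemma exists_hasCode {w : ℝ} (hw : w ∈ Set.Icc (1 / 3 : ℝ) (2 / 3)) (hL : 2 ≤ L) :
    ∃ N d : ℕ, 0 < N ∧ HasCode L N d ∧ N * (w ^ 3 + w ^ L) ≤ 4 * d * w ^ 3 := by
  obtain ⟨hw₁, hw₂⟩ := hw
  have hw₀ : 0 ≤ w := by linarith
  have hw₃ : 0 ≤ w ^ 3 := by positivity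
  rcases eq_or_ne L 2 with rfl | hL₂
  · refine ⟨1, 1, one_pos, hasCode_of_card_le ![univ, (∅ : Finset (Fin 1))] ?_ (by simp) (by simp),
      by push_cast; nlinarith [sq_nonneg w]⟩
    exact_mod_cast (by decide)
  -- For `L = 5`, the code of `hasCode_centralBinom` would require `3 * w ^ 2 ≤ 1`.
  rcases eq_or_ne L 5 with rfl | hL₅
  · refine ⟨5, 2, by norm_num, hasCode_of_card_le
      ![univ, {0, 1, 2}, {1, 3}, {2, 4}, (∅ : Finset (Fin 5))] ?_ (by simp) (by simp), ?_⟩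
    · exact_mod_cast (by decide)
    · have : w ^ 2 ≤ 3 / 5 := by nlinarith
      push_cast
      nlinarith
  obtain ⟨e, rfl⟩ := Nat.exists_eq_add_of_le' (by lia : 3 ≤ L)
  refine ⟨_, _, Nat.centralBinom_pos _, (hasCode_centralBinom (e / 2)).mono (by lia),
    centralBinom_succ_mul_le hw₀ ?_⟩
  rcases le_or_gt 4 e with he | he
  · refine le_trans ?_ (succ_mul_pow_le_one ⟨hw₀, hw₂⟩ he)
    gcongr
    exact_mod_cast Nat.mul_div_le e 2
  · obtain rfl | rfl | rfl : e = 0 ∨ e = 1 ∨ e = 3 := by lia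
    · simp
    · norm_num
      linarith
    · have := pow_le_pow_left₀ hw₀ hw₂ 3
      norm_num at *
      linarith

lemma eventually_hasCode {w δ : ℝ} (hw : w ∈ Set.Icc (1 / 3 : ℝ) (2 / 3)) (hL : 2 ≤ L)
    (hδ : δ < (w ^ 3 + w ^ L) / (4 * w ^ 3)) : ∀ᶠ n : ℕ in atTop, HasCode L n (δ * n) := by
  obtain ⟨N, d, hN, hcode, hle⟩ := exists_hasCode hw hL
  have hw₀ : 0 < w := by linarith [hw.1]
  refine hcode.eventually hN d.cast_nonneg (hδ.trans_le ?_)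
  rw [div_le_div_iff₀ (by positivity) (by exact_mod_cast hN)]
  linarith

lemma exists_hasCode_quarter {M n : ℕ} {ε : ℝ} (hε : 0 ≤ ε)
    (hM : (M : ℝ) ^ 3 < Real.exp (2 * ε ^ 2 * n)) : HasCode M n ((1 / 4 - ε) * n) := by
  obtain ⟨c, hc⟩ := exists_hasListRadius (ι := Fin M) (L := 2) ⟨1 / 2, by norm_num⟩ hε
    (by simpa using hM)
  refine ⟨c, fun i j hij => Or.inl ?_⟩
  have hpair := hc {i, j} card_le_two (c i ⊓ c j)
    (by simp [canReceive_inf_left, canReceive_inf_right]) i (by simp)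
  rw [numErrors_inf_left, card_pair hij] at hpair
  norm_num at hpair ⊢
  exact hpair

end FewWords

/-! ### Two-stage codes from random codes -/

lemma HasListRadius.le_of_le_card {ι : Type*} {n L k : ℕ} {c : ι → Word n} {r : ℕ → ℝ}
    (hc : HasListRadius c L r) (hk : k ∈ Set.Icc 1 L) {S : Finset ι} (hS : k ≤ #S) {y : Word n}
    (hy : ∀ m ∈ S, CanReceive (c m) y) {m : ι} (hm : m ∈ S) : r k ≤ numErrors (c m) y := by
  obtain ⟨T, hmT, hTS, rfl⟩ :=
    exists_subsuperset_card_eq (singleton_subset_iff.2 hm) (by simpa using hk.1) hS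
  exact hc T hk.2 y (fun m' hm' => hy m' (hTS hm')) m (singleton_subset_iff.1 hmT)

lemma exists_corrects_of_hasListRadius {n₁ n₂ M t L₀ : ℕ} [NeZero M] {c : Fin M → Word n₁}
    {r : ℕ → ℝ} (hL₀ : 0 < L₀) (hc : HasListRadius c L₀ r)
    (hshort : ∀ L ∈ Ico 2 L₀, ∃ d, HasCode L n₂ d ∧ t < r L + d)
    (hlong : ∃ d, HasCode M n₂ d ∧ t < r L₀ + d) :
    ∃ E : TwoStageEncoder n₁ n₂ M, E.Corrects t := by
  classical
  have hsecond : ∀ y : Word n₁, ∃ g : Fin M → Word n₂, ∀ m m', m ≠ m' →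
      CanReceive (c m) y → CanReceive (c m') y →
      t < numErrors (c m) y + numErrors (g m) (g m') ∨
      t < numErrors (c m') y + numErrors (g m') (g m) := by
    intro y
    let S : Finset (Fin M) := {m | CanReceive (c m) y}
    have hS : ∀ m, m ∈ S ↔ CanReceive (c m) y := by simp [S]
    simp_rw [← hS]
    rcases lt_or_ge #S 2 with hcard | hcard
    · exact ⟨⊥, fun m m' hne hm hm' =>
        absurd (one_lt_card.2 ⟨m, hm, m', hm', hne⟩) (by lia)⟩
    obtain ⟨k, hk, hkS, L, d, hSL, hcode, ht⟩ : ∃ k ∈ Set.Icc 1 L₀, k ≤ #S ∧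
        ∃ L d, #S ≤ L ∧ HasCode L n₂ d ∧ t < r k + d := by
      rcases lt_or_ge #S L₀ with hlt | hge
      · exact ⟨#S, ⟨by lia, hlt.le⟩, le_rfl, #S, (hshort _ (mem_Ico.2 ⟨hcard, hlt⟩)).imp
          fun d hd => ⟨le_rfl, hd⟩⟩
      · exact ⟨L₀, ⟨hL₀, le_rfl⟩, hge, M, hlong.imp fun d hd => ⟨card_finset_fin_le S, hd⟩⟩
    obtain ⟨g, hg⟩ := hcode.exists_words hSL
    have hr : ∀ m ∈ S, r k ≤ numErrors (c m) y := fun m hm =>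
      hc.le_of_le_card hk hkS (fun m' hm' => (hS m').1 hm') hm
    refine ⟨g, fun m m' hne hm hm' => (hg m hm m' hm' hne).imp (fun hd => ?_) fun hd => ?_⟩
    · exact_mod_cast ht.trans_le (add_le_add (hr m hm) hd)
    · exact_mod_cast ht.trans_le (add_le_add (hr m' hm') hd)
  choose g hg using hsecond
  exact ⟨⟨c, fun m y => g y m⟩, TwoStageEncoder.corrects_of_forall_lt_or_lt fun m m' hne y =>
    hg y m m' hne⟩

lemma eventually_mul_lt_floor_add {α A B σ : ℝ} (hα : α ∈ Set.Icc (0 : ℝ) 1)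
    (hσ : σ < A * α + B * (1 - α)) :
    ∀ᶠ n : ℕ in atTop, σ * n < A * ⌊α * n⌋₊ + B * (n - ⌊α * n⌋₊ : ℕ) := by
  have hfloor : Tendsto (fun n : ℕ => (⌊α * n⌋₊ : ℝ) / n) atTop (𝓝 α) :=
    (tendsto_nat_floor_mul_div_atTop hα.1).comp tendsto_natCast_atTop_atTop
  filter_upwards [((hfloor.const_mul A).add ((hfloor.const_sub 1).const_mul B)).eventually_const_lt
    hσ, eventually_gt_atTop 0] with n hn hn₀
  have hn₀' : (0 : ℝ) < n := by exact_mod_cast hn₀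
  rw [Nat.cast_sub (Nat.floor_le_of_le (mul_le_of_le_one_left hn₀'.le hα.2))]
  calc σ * n < (A * (⌊α * n⌋₊ / n) + B * (1 - ⌊α * n⌋₊ / n)) * n := by gcongr
    _ = _ := by field_simp

lemma tendsto_sub_floor_mul_atTop {α : ℝ} (hα : α ∈ Set.Ico (0 : ℝ) 1) :
    Tendsto (fun n : ℕ => n - ⌊α * n⌋₊) atTop atTop := by
  have hpos : 0 < (1 - α) / 2 := by linarith [hα.2]
  refine tendsto_natCast_atTop_iff.1 (tendsto_atTop_mono' _ ?_
    (tendsto_natCast_atTop_atTop.const_mul_atTop hpos))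
  filter_upwards [eventually_mul_lt_floor_add (A := 0) (B := 1) (Set.Ico_subset_Icc_self hα)
    (by linarith : (1 - α) / 2 < 0 * α + 1 * (1 - α))] with n hn
  linarith

/-- The fraction of the channel uses before the feedback that makes lists of every length equally
hard for the adversary, if the words of the first stage have weight `w`. -/
noncomputable def feedbackFraction (w : ℝ) : ℝ := 1 / (1 + 4 * w ^ 3)

lemma feedbackFraction_mem_Ioo {w : ℝ} (hw : 0 < w) : feedbackFraction w ∈ Set.Ioo (0 : ℝ) 1 := by
  have : 0 < w ^ 3 := by positivity
  exact ⟨by unfold feedbackFraction; positivity, (div_lt_one (by positivity)).2 (by linarith)⟩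

lemma plotkinFun_eq_feedbackFraction {w : ℝ} (hw : 0 < w) (x : ℝ) :
    plotkinFun w = (w - x) * feedbackFraction w +
      (w ^ 3 + x) / (4 * w ^ 3) * (1 - feedbackFraction w) := by
  unfold plotkinFun feedbackFraction
  field_simp
  ring

lemma two_pow_floor_pow_lt_exp {δ x y : ℝ} {k K : ℕ} (hk : k ≤ K) (hδ : 0 ≤ δ * x)
    (h : K * δ * x < y) : ((2 ^ ⌊δ * x⌋₊ : ℕ) : ℝ) ^ k < Real.exp y := by
  have htwo : (2 : ℝ) ≤ Real.exp 1 := by linarith [Real.add_one_le_exp (1 : ℝ)]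
  calc ((2 ^ ⌊δ * x⌋₊ : ℕ) : ℝ) ^ k ≤ (2 ^ ⌊δ * x⌋₊) ^ K := by
        push_cast
        gcongr
        exact one_le_pow₀ one_le_two
    _ ≤ (Real.exp 1 ^ ⌊δ * x⌋₊) ^ K := by gcongr
    _ = Real.exp (K * ⌊δ * x⌋₊) := by rw [← pow_mul, ← Real.exp_nat_mul]; push_cast; ring_nf
    _ < Real.exp y := by
        refine Real.exp_lt_exp.2 (lt_of_le_of_lt ?_ h)
        rw [mul_assoc]
        gcongr
        exact Nat.floor_le hδ

lemma eventually_exists_hasCode_lt {w τ ε : ℝ} (hw : w ∈ Set.Icc (1 / 3 : ℝ) (2 / 3))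
    (hτ₀ : 0 ≤ τ) (hε : 0 < ε) (hτ : τ + ε < plotkinFun w) {L : ℕ} (hL : 2 ≤ L) :
    ∀ᶠ n : ℕ in atTop, ∃ d, HasCode L (n - ⌊feedbackFraction w * n⌋₊) d ∧
      ⌊τ * n⌋₊ < (w - w ^ L - ε) * ⌊feedbackFraction w * n⌋₊ + d := by
  have hw₀ : 0 < w := by linarith [hw.1]
  have hα := feedbackFraction_mem_Ioo hw₀
  rw [plotkinFun_eq_feedbackFraction hw₀ (w ^ L)] at hτ
  filter_upwards [
    (tendsto_sub_floor_mul_atTop ⟨hα.1.le, hα.2⟩).eventually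
      (eventually_hasCode hw hL (sub_lt_self _ hε)),
    eventually_mul_lt_floor_add (A := w - w ^ L - ε) (B := (w ^ 3 + w ^ L) / (4 * w ^ 3) - ε)
      (σ := τ) ⟨hα.1.le, hα.2.le⟩ (by linarith)] with n hcode hn
  exact ⟨_, hcode, (Nat.floor_le (by positivity)).trans_lt hn⟩

lemma exists_eventually_pow_lt_exp {α ε : ℝ} (hα : α ∈ Set.Ioo (0 : ℝ) 1) (hε : 0 < ε) (K : ℕ) :
    ∃ δ > (0 : ℝ), ∀ᶠ n : ℕ in atTop, ∀ k ≤ K,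
      ((2 ^ ⌊δ * n⌋₊ : ℕ) : ℝ) ^ k < Real.exp (2 * ε ^ 2 * ⌊α * n⌋₊) ∧
      ((2 ^ ⌊δ * n⌋₊ : ℕ) : ℝ) ^ k < Real.exp (2 * ε ^ 2 * (n - ⌊α * n⌋₊ : ℕ)) := by
  have hα₁ : 0 < 1 - α := sub_pos.2 hα.2
  have hα₀ := hα.1
  have hδ : 0 < ε ^ 2 * (α * (1 - α)) := by positivity
  have hK : K * (ε ^ 2 * (α * (1 - α)) / (K + 1)) < 2 * (ε ^ 2 * (α * (1 - α))) := by
    rw [mul_div_assoc', div_lt_iff₀ (by positivity)]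
    nlinarith [mul_nonneg hδ.le K.cast_nonneg]
  have hle : ε ^ 2 * (α * (1 - α)) ≤ ε ^ 2 * α ∧ ε ^ 2 * (α * (1 - α)) ≤ ε ^ 2 * (1 - α) := by
    constructor <;> gcongr <;> nlinarith
  refine ⟨ε ^ 2 * (α * (1 - α)) / (K + 1), by positivity, ?_⟩
  filter_upwards [
    eventually_mul_lt_floor_add (A := 2 * ε ^ 2) (B := 0) ⟨hα.1.le, hα.2.le⟩
      (hK.trans_le (by linarith [hle.1])),
    eventually_mul_lt_floor_add (A := 0) (B := 2 * ε ^ 2) ⟨hα.1.le, hα.2.le⟩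
      (hK.trans_le (by linarith [hle.2]))] with n h₁ h₂ k hk
  rw [zero_mul, add_zero] at h₁
  rw [zero_mul, zero_add] at h₂
  exact ⟨two_pow_floor_pow_lt_exp hk (by positivity) h₁,
    two_pow_floor_pow_lt_exp hk (by positivity) h₂⟩

lemma exists_eventually_transmittable {τ : ℝ} (hτ₀ : 0 ≤ τ) (hτ : τ < tauMax) :
    ∃ δ > (0 : ℝ), ∀ᶠ n : ℕ in atTop, Transmittable n ⌊τ * n⌋₊ (2 ^ ⌊δ * n⌋₊) := by
  obtain ⟨w, hw, hwτ, -⟩ := exists_plotkinFun_eq_tauMax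
  have hw₀ : 0 < w := by linarith [hw.1]
  have hα := feedbackFraction_mem_Ioo hw₀
  obtain ⟨ε, hε, hετ⟩ : ∃ ε > 0, τ + 2 * ε < plotkinFun w :=
    ⟨(tauMax - τ) / 3, by linarith, by linarith⟩
  obtain ⟨L₀, hwL₀⟩ := exists_pow_lt_of_lt_one hε (by linarith [hw.2] : w < 1)
  have hwL : w ^ (L₀ + 2) < ε :=
    (pow_le_pow_of_le_one hw₀.le (by linarith [hw.2]) (by lia)).trans_lt hwL₀
  have hlong : τ < (w - w ^ (L₀ + 2) - ε) * feedbackFraction w +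
      (1 / 4 - ε) * (1 - feedbackFraction w) := by
    have hbalance := plotkinFun_eq_feedbackFraction hw₀ 0
    rw [add_zero, div_mul_cancel_right₀ (by positivity)] at hbalance
    nlinarith [mul_lt_mul_of_pos_right hwL hα.1, mul_lt_mul_of_pos_left hα.2 hε]
  obtain ⟨δ, hδ, hsize⟩ := exists_eventually_pow_lt_exp hα hε (L₀ + 3)
  refine ⟨δ, hδ, ?_⟩
  filter_upwards [hsize, eventually_mul_lt_floor_add ⟨hα.1.le, hα.2.le⟩ hlong,
    (eventually_all_finset (Ico 2 (L₀ + 2))).2 fun L hL =>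
      eventually_exists_hasCode_lt hw hτ₀ hε (by linarith) (mem_Ico.1 hL).1,
    (tendsto_nat_floor_atTop.comp
      (tendsto_natCast_atTop_atTop.const_mul_atTop hα.1)).eventually_gt_atTop 1,
    (tendsto_sub_floor_mul_atTop ⟨hα.1.le, hα.2⟩).eventually_gt_atTop 0]
    with n hsize hlong hshort hn₁ hn₂
  obtain ⟨c, hc⟩ := exists_hasListRadius (ι := Fin (2 ^ ⌊δ * n⌋₊)) (L := L₀ + 2)
    ⟨w, hw₀.le, by linarith [hw.2]⟩ hε.le (by simpa using (hsize _ le_rfl).1)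
  exact ⟨_, _, hn₁, hn₂, by lia, exists_corrects_of_hasListRadius (by lia) hc hshort
    ⟨_, exists_hasCode_quarter hε.le (hsize 3 (by lia)).2,
      (Nat.floor_le (by positivity)).trans_lt hlong⟩⟩

lemma rate_pos {τ : ℝ} (hτ₀ : 0 ≤ τ) (hτ : τ < tauMax) : 0 < rate τ := by
  obtain ⟨δ, hδ, htransmit⟩ := exists_eventually_transmittable hτ₀ hτ
  have hrate : Tendsto (fun n : ℕ => (⌊δ * n⌋₊ : ℝ) / n) atTop (𝓝 δ) :=
    (tendsto_nat_floor_mul_div_atTop hδ.le).comp tendsto_natCast_atTop_atTop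
  refine hδ.trans_le (hrate.limsup_eq.ge.trans (limsup_le_limsup ?_ ?_ ?_))
  · filter_upwards [htransmit, eventually_ge_atTop 3] with n hn hn₃
    have hle : ((2 ^ ⌊δ * n⌋₊ : ℕ) : ℝ) ≤ maxMessages n ⌊τ * n⌋₊ := by
      exact_mod_cast (isGreatest_maxMessages hn₃ _).2 hn
    gcongr
    rw [Real.le_logb_iff_rpow_le one_lt_two (lt_of_lt_of_le (by positivity) hle)]
    simpa using hle
  · exact hrate.isCoboundedUnder_le
  · refine isBoundedUnder_of_eventually_le (a := 1) ?_
    filter_upwards [eventually_ge_atTop 3] with n hn₃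
    have hone : (1 : ℝ) ≤ maxMessages n ⌊τ * n⌋₊ := by exact_mod_cast one_le_maxMessages hn₃ _
    refine div_le_one_of_le₀ ?_ n.cast_nonneg
    rw [Real.logb_le_iff_le_rpow one_lt_two (by linarith), Real.rpow_natCast]
    exact_mod_cast (isGreatest_maxMessages hn₃ _).1.le_two_pow

end ZChannel

theorem mainTheorem1 :
    IsGreatest (ZChannel.plotkinFun '' Set.Ioo (0 : ℝ) 1) ZChannel.tauMax ∧
    |ZChannel.tauMax - 0.44| < 0.005 ∧
    (∀ τ : ℝ, 0 ≤ τ → τ < ZChannel.tauMax → 0 < ZChannel.rate τ) ∧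
    (∀ τ : ℝ, ZChannel.tauMax < τ → ZChannel.rate τ = 0) :=
  ⟨ZChannel.isGreatest_tauMax, ZChannel.abs_tauMax_sub_lt, fun _ => ZChannel.rate_pos,
    fun _ => ZChannel.rate_eq_zero⟩
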